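/- A \emph{$\mathcal C^\infty$-ring} is a set $A$ together with, for every $n\ge 0$ and every smooth function $f:\mathbb R^n\to\mathbb R$, an operation $f^A:A^n\to A$, such that the coordinate projections of $\mathbb R^n$ are interpreted as the coordinate projections of $A^n$, and $f^A=h^A\circ(g_1^A,\dots,g_n^A)$ whenever $f=h\circ(g_1,\dots,g_n)$ with $h\in\mathcal C^\infty(\mathbb R^n)$ and $g_1,\dots,g_n\in\mathcal C^\infty(\mathbb R^m)$, for all $m,n\ge 0$. It is a commutative ring with the interpretations of addition and multiplication of $\mathbb R$, and for each ideal $I$ the quotient $A/I$ is again a $\mathcal C^\infty$-ring. For $S\subseteq A$ let $A\to A\{S^{-1}\}$ be the universal homomorphism of $\mathcal C^\infty$-rings that sends the elements of $S$ to units. The $\mathcal C^\infty$-radical of an ideal $I$ is $$\sqrt[\infty]{I}=\{a\in A : (A/I)\{(a+I)^{-1}\}\cong 0\}.$$ Let $\mathrm{Spec}^\infty(A)$ be the set of prime ideals $\mathfrak p$ of $A$ with $\sqrt[\infty]{\mathfrak p}=\mathfrak p$, with the topology generated by the sets $D^\infty(a)=\{\mathfrak p : a\notin\mathfrak p\}$,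 $a\in A$. Let $\mathrm{Sper}^\infty(A)$ be the set of subsets $P\subseteq A$ with $P+P\subseteq P$, $P\cdot P\subseteq P$, $P\cup(-P)=A$ and $\mathrm{supp}^\infty(P):=P\cap(-P)\in\mathrm{Spec}^\infty(A)$, with the topology generated by the sets $H^\infty(a)=\{P : a\in P\setminus\mathrm{supp}^\infty(P)\}$, $a\in A$. \textbf{Theorem.} For every $\mathcal C^\infty$-ring $A$, the spaces $\mathrm{Sper}^\infty(A)$ and $\mathrm{Spec}^\infty(A)$ are spectral, and the map $$\mathrm{supp}^\infty:\mathrm{Sper}^\infty(A)\to\mathrm{Spec}^\infty(A),\qquad P\mapsto P\cap(-P),$$ is a spectral map (it is continuous, and preimages of compact open sets are compact) and a bijection. -/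

import Mathlib

open scoped ContDiff

universe u v w

/-- The smooth functions `ℝⁿ → ℝ`, as a subring of the ring of all functions. -/
def smoothSubring (n : ℕ) : Subring ((Fin n → ℝ) → ℝ) where
  carrier := {f | ContDiff ℝ ∞ f}
  mul_mem' {f g} (hf : ContDiff ℝ ∞ f) (hg : ContDiff ℝ ∞ g) := hf.mul hg
  one_mem' := show ContDiff ℝ ∞ (fun _ => (1 : ℝ)) from contDiff_const
  add_mem' {f g} (hf : ContDiff ℝ ∞ f) (hg : ContDiff ℝ ∞ g) := hf.add hg
  zero_mem' := show ContDiff ℝ ∞ (fun _ => (0 : ℝ)) from contDiff_const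
  neg_mem' {f} (hf : ContDiff ℝ ∞ f) := hf.neg

/-- The ring `C^∞(ℝⁿ, ℝ)` of smooth real functions of `n` variables. -/
abbrev SmoothFun (n : ℕ) : Type := smoothSubring n

namespace SmoothFun

theorem contDiff {n : ℕ} (f : SmoothFun n) : ContDiff ℝ ∞ f.1 := f.2

/-- The projection `ℝⁿ → ℝ` onto the `k`-th coordinate. -/
def proj {n : ℕ} (k : Fin n) : SmoothFun n :=
  ⟨fun x => x k, show ContDiff ℝ ∞ (fun x : Fin n → ℝ => x k) from contDiff_apply ℝ ℝ k⟩

/-- The composite `h ∘ (g₁, …, gₙ)`. -/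
def comp {m n : ℕ} (h : SmoothFun n) (g : Fin n → SmoothFun m) : SmoothFun m :=
  ⟨fun x => h.1 (fun i => (g i).1 x),
    h.contDiff.comp (contDiff_pi.2 fun i => (g i).contDiff)⟩

end SmoothFun

/-- A `C^∞`-ring: a set `A` on which every smooth function `ℝⁿ → ℝ` acts as an `n`-ary operation,
such that projections act as projections and all equations `f = h ∘ (g₁, …, gₙ)` between
smooth functions are preserved. -/
class CInftyRing (A : Type u) where
  /-- The interpretation of a smooth function as an operation. -/
  op : ∀ {n : ℕ}, SmoothFun n → (Fin n → A) → A
  op_proj : ∀ {n : ℕ} (k : Fin n) (x : Fin n → A), op (SmoothFun.proj k) x = x k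
  op_comp : ∀ {m n : ℕ} (h : SmoothFun n) (g : Fin n → SmoothFun m) (x : Fin m → A),
    op (h.comp g) x = op h (fun i => op (g i) x)

namespace CInftyRing

section Ring

variable {A : Type u} [CInftyRing A]

/-- Addition of a `C^∞`-ring: the interpretation of `(x₀, x₁) ↦ x₀ + x₁`. -/
instance : Add A := ⟨fun a b => op (SmoothFun.proj (0 : Fin 2) + SmoothFun.proj 1) ![a, b]⟩

/-- Multiplication of a `C^∞`-ring: the interpretation of `(x₀, x₁) ↦ x₀ * x₁`. -/
instance : Mul A := ⟨fun a b => op (SmoothFun.proj (0 : Fin 2) * SmoothFun.proj 1) ![a, b]⟩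

/-- Negation of a `C^∞`-ring: the interpretation of `x₀ ↦ -x₀`. -/
instance : Neg A := ⟨fun a => op (-SmoothFun.proj (0 : Fin 1)) ![a]⟩

/-- The zero of a `C^∞`-ring: the interpretation of the constant `0`. -/
instance : Zero A := ⟨op (0 : SmoothFun 0) ![]⟩

/-- The unit of a `C^∞`-ring: the interpretation of the constant `1`. -/
instance : One A := ⟨op (1 : SmoothFun 0) ![]⟩

theorem op_add {n : ℕ} (f g : SmoothFun n) (x : Fin n → A) :
    op (f + g) x = op f x + op g x := by
  have h : f + g = (SmoothFun.proj (0 : Fin 2) + SmoothFun.proj 1).comp ![f, g] := by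
    ext y; rfl
  rw [h, op_comp]
  change _ = op _ _
  congr 1; ext i; fin_cases i <;> rfl

theorem op_mul {n : ℕ} (f g : SmoothFun n) (x : Fin n → A) :
    op (f * g) x = op f x * op g x := by
  have h : f * g = (SmoothFun.proj (0 : Fin 2) * SmoothFun.proj 1).comp ![f, g] := by
    ext y; rfl
  rw [h, op_comp]
  change _ = op _ _
  congr 1; ext i; fin_cases i <;> rfl

theorem op_neg {n : ℕ} (f : SmoothFun n) (x : Fin n → A) : op (-f) x = -op f x := by
  have h : -f = (-SmoothFun.proj (0 : Fin 1)).comp ![f] := by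
    ext y; rfl
  rw [h, op_comp]
  change _ = op _ _
  congr 1; ext i; fin_cases i; rfl

theorem op_zero {n : ℕ} (x : Fin n → A) : op (0 : SmoothFun n) x = 0 := by
  have h : (0 : SmoothFun n) = (0 : SmoothFun 0).comp ![] := by
    ext y; rfl
  rw [h, op_comp]
  change _ = op _ _
  congr 1; ext i; exact i.elim0

theorem op_one {n : ℕ} (x : Fin n → A) : op (1 : SmoothFun n) x = 1 := by
  have h : (1 : SmoothFun n) = (1 : SmoothFun 0).comp ![] := by
    ext y; rfl
  rw [h, op_comp]
  change _ = op _ _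
  congr 1; ext i; exact i.elim0

/-- Any three elements are the values of the three projections at one point of `A³`. -/
theorem exists_op_eq (a b c : A) : ∃ (x : Fin 3 → A) (f g h : SmoothFun 3),
    a = op f x ∧ b = op g x ∧ c = op h x :=
  ⟨![a, b, c], SmoothFun.proj 0, SmoothFun.proj 1, SmoothFun.proj 2,
    by rw [op_proj]; rfl, by rw [op_proj]; rfl, by rw [op_proj]; rfl⟩

/-- The underlying commutative ring of a `C^∞`-ring. -/
instance toCommRing : CommRing A where
  add_assoc a b c := by
    obtain ⟨x, f, g, h, rfl, rfl, rfl⟩ := exists_op_eq a b c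
    simp only [← op_add, add_assoc]
  zero_add a := by
    obtain ⟨x, f, -, -, rfl, -, -⟩ := exists_op_eq a a a
    rw [← op_zero x, ← op_add, zero_add]
  add_zero a := by
    obtain ⟨x, f, -, -, rfl, -, -⟩ := exists_op_eq a a a
    rw [← op_zero x, ← op_add, add_zero]
  add_comm a b := by
    obtain ⟨x, f, g, -, rfl, rfl, -⟩ := exists_op_eq a b b
    rw [← op_add, ← op_add, add_comm]
  left_distrib a b c := by
    obtain ⟨x, f, g, h, rfl, rfl, rfl⟩ := exists_op_eq a b c
    simp only [← op_add, ← op_mul, mul_add]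
  right_distrib a b c := by
    obtain ⟨x, f, g, h, rfl, rfl, rfl⟩ := exists_op_eq a b c
    simp only [← op_add, ← op_mul, add_mul]
  zero_mul a := by
    obtain ⟨x, f, -, -, rfl, -, -⟩ := exists_op_eq a a a
    rw [← op_zero x, ← op_mul, zero_mul]
  mul_zero a := by
    obtain ⟨x, f, -, -, rfl, -, -⟩ := exists_op_eq a a a
    rw [← op_zero x, ← op_mul, mul_zero]
  mul_assoc a b c := by
    obtain ⟨x, f, g, h, rfl, rfl, rfl⟩ := exists_op_eq a b c
    simp only [← op_mul, mul_assoc]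
  one_mul a := by
    obtain ⟨x, f, -, -, rfl, -, -⟩ := exists_op_eq a a a
    rw [← op_one x, ← op_mul, one_mul]
  mul_one a := by
    obtain ⟨x, f, -, -, rfl, -, -⟩ := exists_op_eq a a a
    rw [← op_one x, ← op_mul, mul_one]
  mul_comm a b := by
    obtain ⟨x, f, g, -, rfl, rfl, -⟩ := exists_op_eq a b b
    rw [← op_mul, ← op_mul, mul_comm]
  neg_add_cancel a := by
    obtain ⟨x, f, -, -, rfl, -, -⟩ := exists_op_eq a a a
    rw [← op_neg, ← op_add, neg_add_cancel, op_zero]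
  nsmul := nsmulRec
  zsmul := zsmulRec

/-- Evaluation of smooth functions at a point of `Aⁿ`, as a ring homomorphism. -/
def evalHom {n : ℕ} (x : Fin n → A) : SmoothFun n →+* A where
  toFun f := op f x
  map_one' := op_one x
  map_mul' f g := op_mul f g x
  map_zero' := op_zero x
  map_add' f g := op_add f g x

end Ring

/-- Homomorphisms of `C^∞`-rings: maps commuting with all the operations. -/
structure Hom (A : Type u) (B : Type v) [CInftyRing A] [CInftyRing B] where
  toFun : A → B
  map_op : ∀ {n : ℕ} (f : SmoothFun n) (x : Fin n → A),
    toFun (op f x) = op f (fun i => toFun (x i))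

instance (A : Type u) (B : Type v) [CInftyRing A] [CInftyRing B] :
    CoeFun (Hom A B) (fun _ => A → B) := ⟨Hom.toFun⟩

section Quotient

/-- Integrals over `[0, 1]` of smooth functions depend smoothly on parameters. -/
theorem contDiff_integral_param {k : ℕ} (n : ℕ) :
    ∀ {E : Type} [NormedAddCommGroup E] [NormedSpace ℝ E] (G : (Fin k → ℝ) × ℝ → E),
      ContDiff ℝ ∞ G → ContDiff ℝ n (fun x => ∫ t in (0 : ℝ)..1, G (x, t)) := by
  induction n with
  | zero =>
    intro E _ _ G hG
    rw [Nat.cast_zero, contDiff_zero]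
    apply intervalIntegral.continuous_parametric_intervalIntegral_of_continuous'
    exact hG.continuous
  | succ n ih =>
    intro E _ _ G hG
    rw [Nat.cast_succ, contDiff_succ_iff_hasFDerivAt]
    let G' : (Fin k → ℝ) × ℝ → ((Fin k → ℝ) →L[ℝ] E) :=
      fun p => (fderiv ℝ G p).comp (ContinuousLinearMap.inl ℝ (Fin k → ℝ) ℝ)
    have hG' : ContDiff ℝ ∞ G' := by
      have : ContDiff ℝ ∞ (fderiv ℝ G) := hG.fderiv_right (by simp)
      exact this.clm_comp contDiff_const
    have hd : ∀ x t, HasFDerivAt (fun x => G (x, t)) (G' (x, t)) x := by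
      intro x t
      have h1 : HasFDerivAt G (fderiv ℝ G (x, t)) (x, t) :=
        (hG.differentiable (by simp) (x, t)).hasFDerivAt
      exact h1.comp x (hasFDerivAt_prodMk_left x t)
    refine ⟨fun x => ∫ t in (0 : ℝ)..1, G' (x, t), ih G' hG', fun x₀ => ?_⟩
    obtain ⟨C, hC⟩ := ((isCompact_closedBall x₀ 1).prod
      (isCompact_Icc (a := (0 : ℝ)) (b := 1))).exists_bound_of_continuousOn
        hG'.continuous.continuousOn
    refine intervalIntegral.hasFDerivAt_integral_of_dominated_of_fderiv_le
      (F := fun x t => G (x, t)) (F' := fun x t => G' (x, t)) (bound := fun _ => C)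
      (Metric.ball_mem_nhds x₀ one_pos) ?_ ?_ ?_ ?_ ?_ ?_
    · refine Filter.Eventually.of_forall fun x => ?_
      exact (hG.continuous.comp (Continuous.prodMk_right x)).aestronglyMeasurable
    · exact (hG.continuous.comp (Continuous.prodMk_right x₀)).intervalIntegrable 0 1
    · exact (hG'.continuous.comp (Continuous.prodMk_right x₀)).aestronglyMeasurable
    · refine Filter.Eventually.of_forall fun t ht x hx => hC (x, t) ⟨?_, ?_⟩
      · exact Metric.ball_subset_closedBall hx
      · rw [Set.uIoc_of_le zero_le_one] at ht
        exact Set.Ioc_subset_Icc_self ht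
    · exact intervalIntegrable_const
    · exact Filter.Eventually.of_forall fun t _ x _ => hd x t

/-- Hadamard's lemma: `f(y) - f(z) = ∑ᵢ (yᵢ - zᵢ) gᵢ(y, z)` with smooth `gᵢ`. -/
theorem hadamard_lemma {n : ℕ} (f : SmoothFun n) : ∃ g : Fin n → SmoothFun (n + n),
    f.comp (fun i => SmoothFun.proj (Fin.castAdd n i)) -
      f.comp (fun i => SmoothFun.proj (Fin.natAdd n i)) =
    ∑ i, (SmoothFun.proj (Fin.castAdd n i) - SmoothFun.proj (Fin.natAdd n i)) * g i := by
  have hf : ContDiff ℝ ∞ f.1 := f.2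
  let a : (Fin (n + n) → ℝ) → (Fin n → ℝ) := fun x i => x (Fin.castAdd n i)
  let b : (Fin (n + n) → ℝ) → (Fin n → ℝ) := fun x i => x (Fin.natAdd n i)
  have ha : ContDiff ℝ ∞ a := contDiff_pi.2 fun i => contDiff_apply ℝ ℝ _
  have hb : ContDiff ℝ ∞ b := contDiff_pi.2 fun i => contDiff_apply ℝ ℝ _
  let γ : (Fin (n + n) → ℝ) × ℝ → (Fin n → ℝ) := fun p => b p.1 + p.2 • (a p.1 - b p.1)
  have hγ : ContDiff ℝ ∞ γ := by
    have h1 := ha.comp (contDiff_fst (𝕜 := ℝ) (E := Fin (n + n) → ℝ) (F := ℝ) (n := ∞))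
    have h2 := hb.comp (contDiff_fst (𝕜 := ℝ) (E := Fin (n + n) → ℝ) (F := ℝ) (n := ∞))
    exact h2.add (contDiff_snd.smul (h1.sub h2))
  have hf' : ContDiff ℝ ∞ (fderiv ℝ f.1) := hf.fderiv_right (by simp)
  let G : Fin n → (Fin (n + n) → ℝ) × ℝ → ℝ := fun i p => fderiv ℝ f.1 (γ p) (Pi.single i 1)
  have hG : ∀ i, ContDiff ℝ ∞ (G i) := fun i => (hf'.comp hγ).clm_apply contDiff_const
  refine ⟨fun i => ⟨fun x => ∫ t in (0 : ℝ)..1, G i (x, t),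
    contDiff_infty.2 fun k => contDiff_integral_param k (G i) (hG i)⟩, ?_⟩
  ext x
  have hsum : ∀ h : Fin n → SmoothFun (n + n), ((∑ i, h i : SmoothFun (n + n)) :
      (Fin (n + n) → ℝ) → ℝ) x = ∑ i, (h i).1 x := by
    intro h
    rw [AddSubmonoidClass.coe_finsetSum, Finset.sum_apply]
  rw [hsum]
  change f.1 (a x) - f.1 (b x) = ∑ i, (a x i - b x i) * ∫ t in (0 : ℝ)..1, G i (x, t)
  have hderiv : ∀ t : ℝ, HasDerivAt (fun t => f.1 (γ (x, t)))
      (∑ i, (a x i - b x i) * G i (x, t)) t := by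
    intro t
    have h1 : HasDerivAt (fun t : ℝ => γ (x, t)) (a x - b x) t := by
      have := ((hasDerivAt_id t).smul_const (a x - b x)).const_add (b x)
      simpa [γ] using this
    have h2 := ((hf.differentiable (by simp) (γ (x, t))).hasFDerivAt).comp_hasDerivAt t h1
    refine h2.congr_deriv ?_
    rw [pi_eq_sum_univ' (a x - b x), map_sum]
    refine Finset.sum_congr rfl fun i _ => ?_
    rw [map_smul]
    rfl
  have hcont : ∀ i, Continuous fun t : ℝ => G i (x, t) := fun i =>
    (hG i).continuous.comp (Continuous.prodMk_right x)
  have hFTC := intervalIntegral.integral_eq_sub_of_hasDerivAt (a := 0) (b := 1)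
    (fun t _ => hderiv t) (Continuous.intervalIntegrable (by fun_prop) 0 1)
  rw [intervalIntegral.integral_finsetSum
    (fun i _ => Continuous.intervalIntegrable (by fun_prop) 0 1)] at hFTC
  simp only [intervalIntegral.integral_const_mul] at hFTC
  rw [hFTC]
  simp [γ]

variable {A : Type u} [CInftyRing A]

/-- Congruence modulo an ideal is compatible with all smooth operations. -/
theorem op_sub_op_mem (I : Ideal A) {n : ℕ} (f : SmoothFun n) (x y : Fin n → A)
    (h : ∀ i, x i - y i ∈ I) : op f x - op f y ∈ I := by
  obtain ⟨g, hg⟩ := hadamard_lemma f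
  have key := congrArg (evalHom (Fin.append x y)) hg
  simp only [map_sub, map_sum, map_mul] at key
  simp only [evalHom, RingHom.coe_mk, MonoidHom.coe_mk, OneHom.coe_mk, op_comp, op_proj,
    Fin.append_left, Fin.append_right] at key
  rw [key]
  exact I.sum_mem fun i _ => I.mul_mem_right _ (h i)

/-- The quotient `A / I` of a `C^∞`-ring by an ideal of its underlying ring. It has the same
elements as the ring quotient; its ring structure is the one coming from the `C^∞`-structure. -/
def IdealQuot (I : Ideal A) : Type u := Quotient (Submodule.quotientRel I)

/-- The class `a + I`. -/
def IdealQuot.mk (I : Ideal A) (a : A) : IdealQuot I := Quotient.mk (Submodule.quotientRel I) a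

theorem IdealQuot.mk_eq_mk (I : Ideal A) (a b : A) : IdealQuot.mk I a = IdealQuot.mk I b ↔ a - b ∈ I := by
  exact Quotient.eq.trans (Submodule.quotientRel_def I)

/-- A representative of a class. -/
noncomputable def IdealQuot.out {I : Ideal A} (q : IdealQuot I) : A := Quotient.out q

theorem IdealQuot.mk_out {I : Ideal A} (q : IdealQuot I) : IdealQuot.mk I q.out = q := Quotient.out_eq q

theorem IdealQuot.mk_op_out (I : Ideal A) {n : ℕ} (f : SmoothFun n) (x : Fin n → A) :
    IdealQuot.mk I (op f fun i => (IdealQuot.mk I (x i)).out) = IdealQuot.mk I (op f x) := by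
  rw [IdealQuot.mk_eq_mk]
  refine op_sub_op_mem I f _ _ fun i => ?_
  rw [← IdealQuot.mk_eq_mk, IdealQuot.mk_out]

/-- The operations of `A / I` are computed on representatives. -/
noncomputable instance (I : Ideal A) : CInftyRing (IdealQuot I) where
  op f x := IdealQuot.mk I (op f fun i => (x i).out)
  op_proj k x := by rw [op_proj, IdealQuot.mk_out]
  op_comp h g x := by rw [op_comp, IdealQuot.mk_op_out]

/-- The canonical homomorphism `A → A / I`. -/
noncomputable def IdealQuot.hom (I : Ideal A) : Hom A (IdealQuot I) where
  toFun := IdealQuot.mk I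
  map_op f x := (IdealQuot.mk_op_out I f x).symm

end Quotient

section Fractions

variable {A : Type u} [CInftyRing A]

/-- Formal smooth expressions in the elements of `A` and formal inverses of elements of `S`. -/
inductive FracTerm (S : Set A) : Type u
  | of (a : A) : FracTerm S
  | inv (s : S) : FracTerm S
  | op {n : ℕ} (f : SmoothFun n) (x : Fin n → FracTerm S) : FracTerm S

/-- The least congruence on formal expressions for which the quotient is a `C^∞`-ring, the map
from `A` is a homomorphism, and every `s ∈ S` is inverted by its formal inverse. -/
inductive FracRel (S : Set A) : FracTerm S → FracTerm S → Prop
  | refl (t) : FracRel S t t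
  | symm {t t'} : FracRel S t t' → FracRel S t' t
  | trans {t t' t''} : FracRel S t t' → FracRel S t' t'' → FracRel S t t''
  | congr {n : ℕ} (f : SmoothFun n) {x y : Fin n → FracTerm S} :
      (∀ i, FracRel S (x i) (y i)) → FracRel S (.op f x) (.op f y)
  | proj {n : ℕ} (k : Fin n) (x : Fin n → FracTerm S) :
      FracRel S (.op (SmoothFun.proj k) x) (x k)
  | comp {m n : ℕ} (h : SmoothFun n) (g : Fin n → SmoothFun m) (x : Fin m → FracTerm S) :
      FracRel S (.op (h.comp g) x) (.op h fun i => .op (g i) x)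
  | of_op {n : ℕ} (f : SmoothFun n) (x : Fin n → A) :
      FracRel S (.of (CInftyRing.op f x)) (.op f fun i => .of (x i))
  | mul_inv (s : S) :
      FracRel S (.op (SmoothFun.proj (0 : Fin 2) * SmoothFun.proj 1) ![.of s, .inv s])
        (.of 1)

/-- The congruence of `FracRel` as a setoid. -/
def fracSetoid (S : Set A) : Setoid (FracTerm S) :=
  ⟨FracRel S, ⟨FracRel.refl, FracRel.symm, FracRel.trans⟩⟩

/-- The `C^∞`-ring of fractions `A{S⁻¹}`. -/
def Frac (S : Set A) : Type u := Quotient (fracSetoid S)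

/-- The class of a formal expression. -/
def Frac.mk {S : Set A} (t : FracTerm S) : Frac S := Quotient.mk (fracSetoid S) t

theorem Frac.mk_eq_mk {S : Set A} {t t' : FracTerm S} :
    Frac.mk t = Frac.mk t' ↔ FracRel S t t' := Quotient.eq

/-- A formal expression representing a class. -/
noncomputable def Frac.out {S : Set A} (q : Frac S) : FracTerm S := Quotient.out q

theorem Frac.mk_out {S : Set A} (q : Frac S) : Frac.mk q.out = q := Quotient.out_eq q

theorem Frac.mk_op_out {S : Set A} {n : ℕ} (f : SmoothFun n) (x : Fin n → FracTerm S) :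
    Frac.mk (.op f fun i => (Frac.mk (x i)).out) = Frac.mk (.op f x) :=
  Frac.mk_eq_mk.2 (.congr f fun _ => Frac.mk_eq_mk.1 (Frac.mk_out _))

noncomputable instance (S : Set A) : CInftyRing (Frac S) where
  op f x := Frac.mk (.op f fun i => (x i).out)
  op_proj k x := by rw [Frac.mk_eq_mk.2 (.proj _ _), Frac.mk_out]
  op_comp h g x := by rw [Frac.mk_op_out, Frac.mk_eq_mk.2 (.comp _ _ _)]

theorem Frac.op_mk {S : Set A} {n : ℕ} (f : SmoothFun n) (x : Fin n → FracTerm S) :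
    op f (fun i => Frac.mk (x i)) = Frac.mk (.op f x) := Frac.mk_op_out f x

/-- The canonical homomorphism `η_S : A → A{S⁻¹}`. -/
noncomputable def Frac.hom (S : Set A) : Hom A (Frac S) where
  toFun a := Frac.mk (.of a)
  map_op f x := by rw [Frac.op_mk, Frac.mk_eq_mk.2 (.of_op f x)]

theorem Hom.map_one {B : Type v} {C : Type w} [CInftyRing B] [CInftyRing C] (φ : Hom B C) :
    φ 1 = 1 := by
  change φ (op (1 : SmoothFun 0) ![]) = op (1 : SmoothFun 0) ![]
  rw [φ.map_op]
  congr 1; ext i; exact i.elim0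

/-- `L`, with `η : A → L`, is a `C^∞`-ring of fractions of `A` with respect to `S`:
`η` inverts `S` and is universal with this property. -/
structure IsFrac (S : Set A) {L : Type v} [CInftyRing L] (η : Hom A L) : Prop where
  isUnit : ∀ s ∈ S, IsUnit (η s)
  existsUnique_lift : ∀ {B : Type w} [CInftyRing B] (φ : Hom A B), (∀ s ∈ S, IsUnit (φ s)) →
    ∃! ψ : Hom L B, ∀ a, ψ (η a) = φ a

theorem Frac.isUnit_hom {S : Set A} (s : A) (hs : s ∈ S) : IsUnit (Frac.hom S s) := by
  refine IsUnit.of_mul_eq_one (Frac.mk (.inv ⟨s, hs⟩)) ?_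
  have h1 : (1 : Frac S) = Frac.mk (.of 1) := (Frac.hom S).map_one.symm
  rw [h1, ← Frac.mk_eq_mk.2 (.mul_inv ⟨s, hs⟩), ← Frac.op_mk]
  change op _ _ = _
  congr 1; ext i; fin_cases i <;> rfl

/-- The value of a formal expression under a homomorphism that inverts `S`. -/
noncomputable def FracTerm.eval {S : Set A} {B : Type w} [CInftyRing B] (φ : Hom A B) :
    FracTerm S → B
  | .of a => φ a
  | .inv s => Ring.inverse (φ s)
  | .op f x => CInftyRing.op f fun i => (x i).eval φ

theorem FracTerm.eval_eq {S : Set A} {B : Type w} [CInftyRing B] (φ : Hom A B)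
    (hφ : ∀ s ∈ S, IsUnit (φ s)) {t t' : FracTerm S} (h : FracRel S t t') :
    t.eval φ = t'.eval φ := by
  induction h with
  | refl => rfl
  | symm _ ih => exact ih.symm
  | trans _ _ ih ih' => exact ih.trans ih'
  | congr f _ ih => simp only [FracTerm.eval, ih]
  | proj k x => rw [FracTerm.eval, op_proj]
  | comp h g x => simp only [FracTerm.eval, op_comp]
  | of_op f x => simp only [FracTerm.eval, φ.map_op]
  | mul_inv s =>
    simp only [FracTerm.eval]
    rw [op_mul, op_proj, op_proj, φ.map_one]
    exact Ring.mul_inverse_cancel _ (hφ s s.2)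

/-- The construction `A{S⁻¹}` has the universal property of the `C^∞`-ring of fractions. -/
theorem Frac.isFrac (S : Set A) : IsFrac.{u, u, w} S (Frac.hom S) where
  isUnit := Frac.isUnit_hom
  existsUnique_lift := by
    intro B _ φ hφ
    refine ⟨⟨Quotient.lift (fun t => t.eval φ) fun t t' h => FracTerm.eval_eq φ hφ h, ?_⟩, ?_, ?_⟩
    · intro n f x
      have hx : x = fun i => Frac.mk (x i).out := by ext i; rw [Frac.mk_out]
      rw [hx, Frac.op_mk]
      rfl
    · intro a
      rfl
    · rintro ψ hψ
      obtain ⟨ψ, hop⟩ := ψ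
      congr 1
      ext q
      obtain ⟨t, rfl⟩ : ∃ t, Frac.mk t = q := ⟨_, Frac.mk_out q⟩
      change _ = t.eval φ
      induction t with
      | of a => exact hψ a
      | inv s =>
        have h1 := (Frac.mk_eq_mk.2 (FracRel.mul_inv s))
        have h2 := congrArg ψ h1
        rw [← Frac.op_mk, hop] at h2
        rw [op_mul, op_proj, op_proj] at h2
        have h3 : ψ (Frac.mk (.of s)) = φ s := hψ s
        have h4 : ψ (Frac.mk (.of 1)) = 1 := (hψ 1).trans φ.map_one
        change ψ (Frac.mk (.of s)) * ψ (Frac.mk (.inv s)) = ψ (Frac.mk (.of 1)) at h2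
        rw [h3, h4] at h2
        change _ = Ring.inverse (φ s)
        have h5 := Ring.inverse_mul_cancel _ (hφ s s.2)
        calc ψ (Frac.mk (.inv s)) = (Ring.inverse (φ s) * φ s) * ψ (Frac.mk (.inv s)) := by
              rw [h5, one_mul]
          _ = Ring.inverse (φ s) := by rw [mul_assoc, h2, mul_one]
      | op f x ih =>
        rw [← Frac.op_mk, hop]
        simp only [ih]
        rfl

end Fractions

section Spectra

variable {A : Type u} [CInftyRing A]

/-- The `C^∞`-radical of an ideal: the set of `a ∈ A` with `(A / I){(a + I)⁻¹} ≅ 0`. -/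
def radical (I : Ideal A) : Set A :=
  {a | Subsingleton (Frac ({IdealQuot.mk I a} : Set (IdealQuot I)))}

variable (A)

/-- The smooth Zariski spectrum: the `C^∞`-radical prime ideals of `A`. -/
@[ext]
structure Spec where
  asIdeal : Ideal A
  isPrime : asIdeal.IsPrime
  isRadical : radical asIdeal = (asIdeal : Set A)

variable {A}

/-- The basic open set `D^∞(a)`. -/
def Spec.basicOpen (a : A) : Set (Spec A) := {p | a ∉ p.asIdeal}

/-- The smooth Zariski topology. -/
instance : TopologicalSpace (Spec A) :=
  TopologicalSpace.generateFrom (Set.range Spec.basicOpen)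

variable (A)

/-- The smooth real spectrum: the `C^∞`-orderings of `A`. -/
@[ext]
structure Sper where
  carrier : Set A
  add_mem : ∀ {a b : A}, a ∈ carrier → b ∈ carrier → a + b ∈ carrier
  mul_mem : ∀ {a b : A}, a ∈ carrier → b ∈ carrier → a * b ∈ carrier
  mem_or_neg_mem : ∀ a : A, a ∈ carrier ∨ -a ∈ carrier
  exists_support : ∃ p : Spec A, (p.asIdeal : Set A) = {a | a ∈ carrier ∧ -a ∈ carrier}

variable {A}

/-- The `C^∞`-support `P ∩ (-P)` of a `C^∞`-ordering `P`. -/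
noncomputable def supp (P : Sper A) : Spec A := P.exists_support.choose

theorem coe_supp (P : Sper A) :
    ((supp P).asIdeal : Set A) = {a | a ∈ P.carrier ∧ -a ∈ P.carrier} :=
  P.exists_support.choose_spec

/-- The subbasic open set `H^∞(a)`. -/
def Sper.harrison (a : A) : Set (Sper A) := {P | a ∈ P.carrier \ (supp P).asIdeal}

/-- The smooth Harrison topology. -/
instance : TopologicalSpace (Sper A) :=
  TopologicalSpace.generateFrom (Set.range Sper.harrison)

end Spectra

end CInftyRing

/-! ### Smoothness of the square root of x times exp(-1/x). -/

section Glue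

open Polynomial Real Filter Set Topology

namespace expNegInvGlue

/-! Everything reduces to zero sets of smooth functions: an ideal equals its radical exactly when it
is `ZeroClosed`. If h(x) lies in I and f vanishes on the zeros of h, then inverting f(x) modulo I
kills the ring, because h² + (f·y - 1)² has no real zero and is therefore a unit (`op_mem_radical`).
Conversely, if a lies in the radical, the universal property is tested on the ring of all real
functions on ℝ^A, modulo those vanishing where ρ(a) ≠ 0 and some relation from I holds. There a
becomes invertible, so this ring is zero, which says that a vanishes on the zeros of one element of
I (`exists_zeros_of_mem_radical`, `ZeroClosed.radical_eq`).

`ZeroClosed` is a family of conditions on two memberships each, so the points of `Spec A` form a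
closed subset of the Cantor cube Bool^A. This makes every basic open set compact. Generic points are
intersections of primes, since `ZeroClosed` survives intersections.

For the real spectrum, let g be the smooth function equal to exp(-1/x) for x > 0 and 0 elsewhere.
Modulo a radical prime p, g(-a) = 0 expresses a ≥ 0, so {a : g(-a) ∈ p} is an ordering with support
p. It is the only one: a·g(a)² is the square of a smooth expression in a, hence a ∈ P forces g(-a)
into the support (`Sper.posGlue_neg_mem`). Finally H(a) is the preimage of D(g(a)) and the preimage
of D(a) is H(a²), so the support map is a homeomorphism. -/

theorem hasDerivAt_sqrt_mul_polynomial_eval_inv_mul (p : ℝ[X]) (x : ℝ) :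
    HasDerivAt (fun x ↦ √x * (p.eval x⁻¹ * expNegInvGlue x))
      (√x * ((C (1 / 2) * X * p + X ^ 2 * (p - derivative (R := ℝ) p)).eval x⁻¹ *
        expNegInvGlue x)) x := by
  rcases lt_trichotomy x 0 with hx | rfl | hx
  · rw [zero_of_nonpos hx.le, mul_zero, mul_zero]
    refine (hasDerivAt_const _ 0).congr_of_eventuallyEq ?_
    filter_upwards [gt_mem_nhds hx] with y hy
    rw [zero_of_nonpos hy.le, mul_zero, mul_zero]
  · rw [expNegInvGlue.zero, mul_zero, mul_zero, hasDerivAt_iff_tendsto_slope]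
    -- The difference quotient at 0 has the same form, with `p * X` in place of `p`.
    have h : Tendsto (fun x ↦ √x * ((p * X).eval x⁻¹ * expNegInvGlue x)) (𝓝 0) (𝓝 0) := by
      simpa only [sqrt_zero, zero_mul] using
        (continuous_sqrt.tendsto 0).mul (tendsto_polynomial_inv_mul_zero (p * X))
    refine (h.mono_left inf_le_left).congr fun x ↦ ?_
    simp only [slope_def_field, eval_mul, eval_X, expNegInvGlue.zero, sqrt_zero, sub_zero, mul_zero]
    ring
  · refine ((hasDerivAt_sqrt hx.ne').mul
      (hasDerivAt_polynomial_eval_inv_mul p x)).congr_deriv ?_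
    -- Keeping √x as a factor turns its derivative into the term `C (1 / 2) * X * p`.
    have h : 1 / (2 * √x) = √x * (1 / 2 * x⁻¹) := by
      have h1 : √x ≠ 0 := (sqrt_pos.2 hx).ne'
      have h2 : √x * √x = x := mul_self_sqrt hx.le
      field_simp
      rw [sq, h2]
    rw [h]
    simp only [eval_add, eval_mul, eval_C, eval_X, eval_pow]
    ring

/-- With an arbitrary polynomial the family is closed under differentiation, so induction on the
order applies. -/
theorem contDiff_sqrt_mul_polynomial_eval_inv_mul {n : ℕ∞} (p : ℝ[X]) :
    ContDiff ℝ n (fun x ↦ √x * (p.eval x⁻¹ * expNegInvGlue x)) := by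
  have hd (p : ℝ[X]) : Differentiable ℝ (fun x ↦ √x * (p.eval x⁻¹ * expNegInvGlue x)) :=
    fun x ↦ (hasDerivAt_sqrt_mul_polynomial_eval_inv_mul p x).differentiableAt
  apply contDiff_all_iff_nat.2 (fun m => ?_) n
  induction m generalizing p with
  | zero => exact contDiff_zero.2 (hd p).continuous
  | succ m ihm =>
    rw [show ((m + 1 : ℕ) : WithTop ℕ∞) = m + 1 from rfl]
    refine contDiff_succ_iff_deriv.2 ⟨hd p, by simp, ?_⟩
    convert! ihm (C (1 / 2) * X * p + X ^ 2 * (p - derivative (R := ℝ) p)) using 2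
    exact (hasDerivAt_sqrt_mul_polynomial_eval_inv_mul p _).deriv

/-- The product of the square root and `expNegInvGlue` is smooth. -/
theorem contDiff_sqrt_mul {n : ℕ∞} : ContDiff ℝ n (fun x ↦ √x * expNegInvGlue x) := by
  simpa using contDiff_sqrt_mul_polynomial_eval_inv_mul (n := n) 1

end expNegInvGlue

end Glue

/-! ### The radical in terms of zero sets. -/

namespace CInftyRing

section Radical

theorem Hom.map_zero {B : Type v} {C : Type w} [CInftyRing B] [CInftyRing C] (φ : Hom B C) :
    φ 0 = 0 := by
  change φ (op (0 : SmoothFun 0) ![]) = _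
  rw [φ.map_op, op_zero]

theorem Hom.map_mul {B : Type v} {C : Type w} [CInftyRing B] [CInftyRing C] (φ : Hom B C)
    (a b : B) : φ (a * b) = φ a * φ b := by
  change φ (op _ ![a, b]) = op _ ![φ a, φ b]
  rw [φ.map_op]
  congr 1; ext i; fin_cases i <;> rfl

variable {A : Type u} [CInftyRing A]

theorem isUnit_op_of_forall_ne_zero {n : ℕ} (k : SmoothFun n) (hk : ∀ t, k.1 t ≠ 0) (x : Fin n → A) :
    IsUnit (op k x) := by
  let l : SmoothFun n := ⟨fun t => (k.1 t)⁻¹, k.contDiff.inv hk⟩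
  have h : k * l = 1 := by
    ext t
    exact mul_inv_cancel₀ (hk t)
  exact IsUnit.of_mul_eq_one (op l x) (by rw [← op_mul, h, op_one])

/-- If `f` vanishes on the zeros of `h`, then `f(x)` can only be invertible together with
`h(x) = 0` in the zero ring. -/
theorem subsingleton_of_isUnit_op {n : ℕ} {h f : SmoothFun n} (hZ : ∀ t, h.1 t = 0 → f.1 t = 0)
    (x : Fin n → A) (hh : op h x = 0) (hf : IsUnit (op f x)) : Subsingleton A := by
  obtain ⟨b, hb⟩ := hf.exists_right_inv
  let z : Fin (n + 1) → A := Fin.cons b x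
  let h' : SmoothFun (n + 1) := h.comp fun i => SmoothFun.proj i.succ
  let f' : SmoothFun (n + 1) := f.comp fun i => SmoothFun.proj i.succ
  -- Variable 0 stands for the inverse `b` of f(x). A real zero of `k` would be a zero of `h` at
  -- which `f` is nonzero, yet `k` evaluates to 0 at `z`.
  let k : SmoothFun (n + 1) := h' * h' + (f' * SmoothFun.proj 0 - 1) * (f' * SmoothFun.proj 0 - 1)
  have hk : ∀ t, k.1 t ≠ 0 := by
    intro t ht
    let s : Fin n → ℝ := fun i => t i.succ
    change h.1 s * h.1 s + (f.1 s * t 0 - 1) * (f.1 s * t 0 - 1) = 0 at ht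
    have h1 : h.1 s = 0 := by nlinarith [mul_self_nonneg (h.1 s), mul_self_nonneg (f.1 s * t 0 - 1)]
    rw [h1, hZ s h1] at ht
    norm_num at ht
  have h1 : op h' z = 0 := by
    rw [op_comp, ← hh]
    simp only [op_proj, z, Fin.cons_succ]
  have h2 : op f' z = op f x := by
    rw [op_comp]
    simp only [op_proj, z, Fin.cons_succ]
  have h3 : evalHom z k = 0 := by
    simp only [k, map_add, map_mul, map_sub, map_one]
    simp only [evalHom, RingHom.coe_mk, MonoidHom.coe_mk, OneHom.coe_mk, h1, h2, op_proj]
    simp only [z, Fin.cons_zero, hb]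
    ring
  have h4 := isUnit_op_of_forall_ne_zero k hk z
  rw [show op k z = 0 from h3, isUnit_zero_iff] at h4
  exact subsingleton_of_zero_eq_one h4

/-- In the localization h(x) is zero and f(x) is a unit, so `subsingleton_of_isUnit_op` applies. -/
theorem op_mem_radical (I : Ideal A) {n : ℕ} {h f : SmoothFun n}
    (hZ : ∀ t, h.1 t = 0 → f.1 t = 0) (x : Fin n → A) (hh : op h x ∈ I) : op f x ∈ radical I := by
  let η := Frac.hom ({IdealQuot.mk I (op f x)} : Set (IdealQuot I))
  have key (k : SmoothFun n) : op k (fun i => η (IdealQuot.hom I (x i))) =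
      η (IdealQuot.hom I (op k x)) := by rw [(IdealQuot.hom I).map_op, η.map_op]
  refine subsingleton_of_isUnit_op hZ (fun i => η (IdealQuot.hom I (x i))) ?_ ?_
  · have h0 : IdealQuot.hom I (op h x) = IdealQuot.hom I 0 :=
      (IdealQuot.mk_eq_mk I _ _).2 (by rwa [sub_zero])
    rw [key, h0, Hom.map_zero, Hom.map_zero]
  · rw [key]
    exact Frac.isUnit_hom _ rfl

/-- The `C^∞`-ring of all real functions on a set. -/
def RealFun (X : Type u) : Type u := X → ℝ

instance (X : Type u) : CInftyRing (RealFun X) where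
  op f x := fun ρ => f.1 fun i => x i ρ
  op_proj _ _ := rfl
  op_comp _ _ _ := rfl

/-- Membership in `p` is inherited along inclusions of zero sets of smooth functions. -/
def ZeroClosed (p : Set A) : Prop :=
  ∀ (n : ℕ) (h f : SmoothFun n) (x : Fin n → A), (∀ t, h.1 t = 0 → f.1 t = 0) →
    op h x ∈ p → op f x ∈ p

/-- The functions on `ℝ^A` that vanish at all points outside the zero set of `a` at which some
element of `I`, written as a smooth function of finitely many elements of `A`, vanishes. -/
def vanishingIdeal (I : Ideal A) (a : A) : Ideal (RealFun (A → ℝ)) where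
  carrier := {F | ∃ (n : ℕ) (h : SmoothFun n) (x : Fin n → A), op h x ∈ I ∧
    ∀ ρ : A → ℝ, h.1 (fun i => ρ (x i)) = 0 → ρ a ≠ 0 → F ρ = (0 : ℝ)}
  zero_mem' := ⟨0, 0, ![], by rw [op_zero]; exact I.zero_mem, fun _ _ _ => rfl⟩
  add_mem' := by
    rintro F G ⟨m, h, x, hx, hF⟩ ⟨n, k, y, hy, hG⟩
    let h' : SmoothFun (m + n) := h.comp fun i => SmoothFun.proj (Fin.castAdd n i)
    let k' : SmoothFun (m + n) := k.comp fun i => SmoothFun.proj (Fin.natAdd m i)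
    -- The real zeros of a sum of squares are the common zeros.
    refine ⟨m + n, h' * h' + k' * k', Fin.append x y, ?_, fun ρ hρ ha => ?_⟩
    · rw [op_add, op_mul, op_mul, op_comp, op_comp]
      simp only [op_proj, Fin.append_left, Fin.append_right]
      exact I.add_mem (I.mul_mem_left _ hx) (I.mul_mem_left _ hy)
    · have e : ∀ s : Fin (m + n) → ℝ, (h' * h' + k' * k').1 s =
        h.1 (fun i => s (Fin.castAdd n i)) * h.1 (fun i => s (Fin.castAdd n i)) +
          k.1 (fun i => s (Fin.natAdd m i)) * k.1 (fun i => s (Fin.natAdd m i)) := fun _ => rfl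
      rw [e] at hρ
      simp only [Fin.append_left, Fin.append_right] at hρ
      obtain ⟨h1, h2⟩ := (add_eq_zero_iff_of_nonneg (mul_self_nonneg _) (mul_self_nonneg _)).1 hρ
      change (F ρ + G ρ : ℝ) = 0
      rw [hF ρ (mul_self_eq_zero.1 h1) ha, hG ρ (mul_self_eq_zero.1 h2) ha, add_zero]
  smul_mem' := by
    rintro G F ⟨n, h, x, hx, hF⟩
    refine ⟨n, h, x, hx, fun ρ hρ ha => ?_⟩
    change (G ρ * F ρ : ℝ) = 0
    rw [hF ρ hρ ha, mul_zero]

/-- The class of the evaluation at `b` modulo the vanishing ideal. -/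
def coordinate (I : Ideal A) (a b : A) : IdealQuot (vanishingIdeal I a) :=
  IdealQuot.mk _ fun ρ : A → ℝ => ρ b

theorem coordinate_eq (I : Ideal A) (a : A) {b c : A} (h : b - c ∈ I) :
    coordinate I a b = coordinate I a c := by
  refine (IdealQuot.mk_eq_mk _ _ _).2
    ⟨2, SmoothFun.proj 0 - SmoothFun.proj 1, ![b, c], ?_, fun ρ hρ _ => ?_⟩
  · have := (evalHom ![b, c]).map_sub (SmoothFun.proj 0) (SmoothFun.proj 1)
    simp only [evalHom, RingHom.coe_mk, MonoidHom.coe_mk, OneHom.coe_mk, op_proj] at this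
    rw [this]
    exact h
  · change ρ b + -ρ c = 0
    rw [← sub_eq_add_neg]
    exact hρ

/-- The points ρ are arbitrary maps, but y₀ - f(y₁, …, yₙ) evaluates to 0 ∈ I at (f(x), x), and on
its zeros ρ respects this instance of `f`. -/
theorem coordinate_op (I : Ideal A) (a : A) {n : ℕ} (f : SmoothFun n) (x : Fin n → A) :
    coordinate I a (op f x) = op f fun i => coordinate I a (x i) := by
  refine Eq.trans ?_ ((IdealQuot.hom (vanishingIdeal I a)).map_op f
    fun i => (fun ρ => ρ (x i) : RealFun (A → ℝ)))
  let f' : SmoothFun (n + 1) := f.comp fun i => SmoothFun.proj i.succ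
  refine (IdealQuot.mk_eq_mk _ _ _).2
    ⟨n + 1, SmoothFun.proj 0 - f', Fin.cons (op f x) x, ?_, fun ρ hρ _ => ?_⟩
  · have := (evalHom (Fin.cons (op f x) x : Fin (n + 1) → A)).map_sub (SmoothFun.proj 0) f'
    simp only [evalHom, RingHom.coe_mk, MonoidHom.coe_mk, OneHom.coe_mk, op_proj, f', op_comp,
      Fin.cons_succ, Fin.cons_zero, sub_self] at this
    rw [this]
    exact I.zero_mem
  · change ρ (op f x) + -(f.1 fun i => ρ (x i)) = 0
    rw [← sub_eq_add_neg]
    exact hρ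

theorem isUnit_coordinate (I : Ideal A) (a : A) : IsUnit (coordinate I a a) := by
  -- The inverse need not be smooth, since all real functions are allowed. Its default value 0 where
  -- ρ(a) = 0 is harmless: the ideal imposes nothing there.
  refine IsUnit.of_mul_eq_one (IdealQuot.hom (vanishingIdeal I a) fun ρ => (ρ a)⁻¹) ?_
  rw [← (IdealQuot.hom (vanishingIdeal I a)).map_one]
  refine ((IdealQuot.hom (vanishingIdeal I a)).map_mul _ _).symm.trans
    ((IdealQuot.mk_eq_mk _ _ _).2 ⟨0, 0, ![], ?_, fun ρ _ ha => ?_⟩)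
  · rw [op_zero]
    exact I.zero_mem
  · change ρ a * (ρ a)⁻¹ + -1 = 0
    rw [mul_inv_cancel₀ ha, add_neg_cancel]

/-- The homomorphism from `A / I` given by the coordinates. -/
noncomputable def coordinateHom (I : Ideal A) (a : A) :
    Hom (IdealQuot I) (IdealQuot (vanishingIdeal I a)) where
  toFun q := coordinate I a q.out
  map_op f x := by
    rw [← coordinate_op]
    exact coordinate_eq I a ((IdealQuot.mk_eq_mk _ _ _).1 (IdealQuot.mk_out _))

theorem coordinateHom_mk (I : Ideal A) (a b : A) :
    coordinateHom I a (IdealQuot.mk I b) = coordinate I a b :=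
  coordinate_eq I a ((IdealQuot.mk_eq_mk _ _ _).1 (IdealQuot.mk_out _))

/-- `coordinateHom` inverts a, so it factors through the zero ring. Hence 1 lies in the vanishing
ideal, and the witness of this membership is the required `h`. -/
theorem exists_zeros_of_mem_radical {I : Ideal A} {a : A} (ha : a ∈ radical I) :
    ∃ (n : ℕ) (h : SmoothFun n) (x : Fin n → A), op h x ∈ I ∧
      ∀ ρ : A → ℝ, h.1 (fun i => ρ (x i)) = 0 → ρ a = 0 := by
  obtain ⟨ψ, -, -⟩ := (Frac.isFrac ({IdealQuot.mk I a} : Set (IdealQuot I))).existsUnique_lift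
    (coordinateHom I a) (by
      rintro _ rfl
      rw [coordinateHom_mk]
      exact isUnit_coordinate I a)
  have hsub : Subsingleton (Frac ({IdealQuot.mk I a} : Set (IdealQuot I))) := ha
  have h1 : (0 : IdealQuot (vanishingIdeal I a)) = 1 := by
    rw [← ψ.map_zero, ← ψ.map_one, Subsingleton.elim (1 : Frac _) 0]
  rw [← (IdealQuot.hom (vanishingIdeal I a)).map_zero,
    ← (IdealQuot.hom (vanishingIdeal I a)).map_one] at h1
  obtain ⟨n, h, x, hx, H⟩ := (IdealQuot.mk_eq_mk _ _ _).1 h1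
  refine ⟨n, h, x, hx, fun ρ hρ => ?_⟩
  by_contra hne
  have h2 := H ρ hρ hne
  change (0 : ℝ) + -1 = 0 at h2
  norm_num at h2

theorem ZeroClosed.radical_eq {I : Ideal A} (hI : ZeroClosed (I : Set A)) :
    radical I = (I : Set A) := by
  classical
  refine Set.Subset.antisymm (fun a ha => ?_) fun a ha => ?_
  · obtain ⟨n, h, x, hx, H⟩ := exists_zeros_of_mem_radical ha
    -- The entries of `x` may repeat or include `a`. Listing the distinct elements injectively lets
    -- every real tuple `t` extend to a point of ℝ^A.
    let s : Finset A := insert a (Finset.univ.image x)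
    let y : Fin s.card → A := fun j => (s.equivFin.symm j : A)
    have hy : Function.Injective y := Subtype.val_injective.comp s.equivFin.symm.injective
    have hsurj (b : A) (hb : b ∈ s) : y (s.equivFin ⟨b, hb⟩) = b := by simp [y]
    let j := s.equivFin ⟨a, Finset.mem_insert_self _ _⟩
    let σ : Fin n → Fin s.card := fun i => s.equivFin ⟨x i, by simp [s]⟩
    have := hI _ (h.comp fun i => SmoothFun.proj (σ i)) (SmoothFun.proj j) y (fun t ht => ?_) ?_
    · rwa [op_proj, hsurj] at this
    · have key : ∀ j, Function.extend y t 0 (y j) = t j := hy.extend_apply t 0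
      have h1 := H (Function.extend y t 0) (by
        rw [← ht]
        change h.1 _ = h.1 fun i => t (σ i)
        refine congrArg h.1 (funext fun i => ?_)
        rw [← key (σ i), hsurj])
      rw [← hsurj a (Finset.mem_insert_self _ _), key] at h1
      exact h1
    · rw [op_comp]
      simp only [op_proj, σ, hsurj]
      exact hx
  · have := op_mem_radical I (h := SmoothFun.proj 0) (f := SmoothFun.proj 0) (fun _ => id) ![a]
      (by rw [op_proj]; exact ha)
    rwa [op_proj] at this

theorem Spec.zeroClosed (p : Spec A) : ZeroClosed (p.asIdeal : Set A) := fun _ _ _ x hZ hh => by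
  rw [← p.isRadical]
  exact op_mem_radical _ hZ x hh

end Radical

end CInftyRing

/-! ### The smooth Zariski spectrum is spectral. -/

namespace CInftyRing

section Zariski

variable {A : Type u} [CInftyRing A]

theorem Spec.basicOpen_one : Spec.basicOpen (1 : A) = Set.univ :=
  Set.eq_univ_of_forall fun p => (Ideal.ne_top_iff_one _).1 p.isPrime.ne_top

theorem Spec.basicOpen_mul (a b : A) :
    Spec.basicOpen (a * b) = Spec.basicOpen a ∩ Spec.basicOpen b := by
  ext p
  have := p.isPrime
  simp only [basicOpen, Set.mem_ofPred_eq, Set.mem_inter_iff, Ideal.IsPrime.mul_mem_iff_mem_or_mem,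
    not_or]

theorem Spec.isOpen_basicOpen (a : A) : IsOpen (Spec.basicOpen a) :=
  TopologicalSpace.isOpen_generateFrom_of_mem ⟨a, rfl⟩

theorem Spec.isTopologicalBasis_basicOpen :
    TopologicalSpace.IsTopologicalBasis (Set.range (Spec.basicOpen (A := A))) where
  exists_subset_inter := by
    rintro _ ⟨a, rfl⟩ _ ⟨b, rfl⟩ p hp
    exact ⟨_, ⟨a * b, rfl⟩, by rwa [basicOpen_mul], (basicOpen_mul a b).subset⟩
  sUnion_eq := Set.eq_univ_of_univ_subset
    (Set.subset_sUnion_of_mem ⟨1, basicOpen_one⟩)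
  eq_generateFrom := rfl

instance : T0Space (Spec A) where
  t0 p q h := by
    ext a
    exact not_iff_not.1 (h.mem_open_iff (Spec.isOpen_basicOpen a))

variable (A) in
/-- The indicator functions of the prime ideals closed under inclusions of zero sets. -/
def zeroClosedPrimes : Set (A → Bool) :=
  {χ | χ 0 = true ∧ χ 1 = false ∧ (∀ a b, χ a = true → χ b = true → χ (a + b) = true) ∧
    (∀ a b, χ b = true → χ (a * b) = true) ∧
    (∀ a b, χ (a * b) = true → χ a = true ∨ χ b = true) ∧ ZeroClosed {a | χ a = true}}

/-- Each single condition involves at most three coordinates of `χ`, so the set is an intersection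
of clopen sets. -/
theorem isClosed_zeroClosedPrimes : IsClosed (zeroClosedPrimes A) := by
  have hc (a : A) (b : Bool) : IsClopen {χ : A → Bool | χ a = b} :=
    (isClopen_discrete {b}).preimage (continuous_apply a)
  simp only [zeroClosedPrimes, ZeroClosed, Set.ofPred_and, Set.ofPred_forall, Set.mem_ofPred_eq]
  refine (hc _ _).1.inter ((hc _ _).1.inter (.inter ?_ (.inter ?_ (.inter ?_ ?_))))
  · exact isClosed_iInter fun a => isClosed_iInter fun b =>
      isClosed_imp (hc _ _).2 (isClosed_imp (hc _ _).2 (hc _ _).1)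
  · exact isClosed_iInter fun a => isClosed_iInter fun b => isClosed_imp (hc _ _).2 (hc _ _).1
  · exact isClosed_iInter fun a => isClosed_iInter fun b => isClosed_imp (hc _ _).2
      ((hc _ _).1.union (hc _ _).1)
  · exact isClosed_iInter fun n => isClosed_iInter fun h => isClosed_iInter fun f =>
      isClosed_iInter fun x => isClosed_iInter fun _ => isClosed_imp (hc _ _).2 (hc _ _).1

/-- The point of the smooth Zariski spectrum given by an indicator function. -/
def Spec.ofIndicator (χ : zeroClosedPrimes A) : Spec A :=
  have h := χ.2
  let I : Ideal A :=
    { carrier := {a | χ.1 a = true}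
      zero_mem' := h.1
      add_mem' := h.2.2.1 _ _
      smul_mem' := h.2.2.2.1 }
  { asIdeal := I
    isPrime := ⟨(Ideal.ne_top_iff_one _).2 (Bool.eq_false_iff.1 h.2.1), h.2.2.2.2.1 _ _⟩
    isRadical := ZeroClosed.radical_eq (I := I) h.2.2.2.2.2 }

theorem Spec.mem_ofIndicator (χ : zeroClosedPrimes A) (a : A) :
    a ∈ (ofIndicator χ).asIdeal ↔ χ.1 a = true := Iff.rfl

theorem Spec.surjective_ofIndicator : Function.Surjective (ofIndicator (A := A)) := by
  classical
  intro p
  have h := p.isPrime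
  refine ⟨⟨fun a => decide (a ∈ p.asIdeal), ?_⟩, ?_⟩
  · simp only [zeroClosedPrimes, Set.mem_ofPred_eq, decide_eq_true_eq, decide_eq_false_iff_not]
    exact ⟨p.asIdeal.zero_mem, (Ideal.ne_top_iff_one _).1 h.ne_top,
      fun _ _ => p.asIdeal.add_mem, fun a _ => p.asIdeal.mul_mem_left a,
      fun _ _ => h.mem_or_mem, p.zeroClosed⟩
  · ext a
    rw [mem_ofIndicator, decide_eq_true_eq]

theorem Spec.continuous_ofIndicator : Continuous (ofIndicator (A := A)) := by
  refine continuous_generateFrom_iff.2 ?_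
  rintro _ ⟨a, rfl⟩
  exact ((isClopen_discrete {true}ᶜ).preimage
    ((continuous_apply a).comp continuous_subtype_val)).isOpen

/-- It is the continuous image of a clopen subset of a compact space. -/
theorem Spec.isCompact_basicOpen (a : A) : IsCompact (Spec.basicOpen a) := by
  have : CompactSpace (zeroClosedPrimes A) :=
    isCompact_iff_compactSpace.1 isClosed_zeroClosedPrimes.isCompact
  rw [← Set.image_preimage_eq (basicOpen a) surjective_ofIndicator]
  refine IsCompact.image (IsClosed.isCompact ?_) continuous_ofIndicator
  exact ((isClopen_discrete {true}ᶜ).preimage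
    ((continuous_apply a).comp continuous_subtype_val)).isClosed

/-- The generic point is the intersection of the primes in `S`. Irreducibility makes it prime, and
closedness recovers `S` as the primes above it. -/
theorem Spec.exists_eq_closure_singleton {S : Set (Spec A)} (hS : IsIrreducible S)
    (hc : IsClosed S) : ∃ p : Spec A, closure {p} = S := by
  have hne {a : A} (ha : ¬ ∀ q ∈ S, a ∈ q.asIdeal) : (S ∩ basicOpen a).Nonempty := by
    push Not at ha
    exact ha
  let I : Ideal A := ⨅ q ∈ S, q.asIdeal
  have hI (a : A) : a ∈ I ↔ ∀ q ∈ S, a ∈ q.asIdeal := by simp only [I, Submodule.mem_iInf]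
  let p : Spec A :=
    { asIdeal := I
      isPrime := by
        refine ⟨(Ideal.ne_top_iff_one _).2 fun h => ?_, fun {a b} hab => ?_⟩
        · obtain ⟨q, hq⟩ := hS.1
          exact (Ideal.ne_top_iff_one _).1 q.isPrime.ne_top ((hI 1).1 h q hq)
        · by_contra! hn
          rw [hI, hI] at hn
          obtain ⟨q, hq, hqa, hqb⟩ := hS.2 _ _ (isOpen_basicOpen a) (isOpen_basicOpen b)
            (hne hn.1) (hne hn.2)
          exact (q.isPrime.mem_or_mem ((hI _).1 hab q hq)).elim hqa hqb
      isRadical := ZeroClosed.radical_eq fun n h f x hZ hh =>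
        (hI _).2 fun q hq => q.zeroClosed n h f x hZ ((hI _).1 hh q hq) }
  have hp (q : Spec A) : q ∈ S ↔ p.asIdeal ≤ q.asIdeal := by
    refine ⟨fun hq a ha => (hI a).1 ha q hq, fun hq => ?_⟩
    by_contra hqS
    obtain ⟨_, ⟨a, rfl⟩, hqa, ha⟩ :=
      isTopologicalBasis_basicOpen.exists_subset_of_mem_open hqS hc.isOpen_compl
    refine hqa (hq ((hI a).2 fun r hr => ?_))
    by_contra hra
    exact ha hra hr
  refine ⟨p, Set.Subset.antisymm (hc.closure_subset_iff.2 ?_) fun q hq => ?_⟩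
  · exact Set.singleton_subset_iff.2 ((hp p).2 le_rfl)
  · refine isTopologicalBasis_basicOpen.mem_closure_iff.2 ?_
    rintro _ ⟨a, rfl⟩ ha
    exact ⟨p, fun hpa => ha ((hp q).1 hq hpa), rfl⟩

instance : SpectralSpace (Spec A) where
  isCompact_univ := by
    rw [← Spec.basicOpen_one]
    exact Spec.isCompact_basicOpen 1
  sober := Spec.exists_eq_closure_singleton
  toQuasiSeparatedSpace := .of_isTopologicalBasis Spec.isTopologicalBasis_basicOpen fun a b => by
    rw [← Spec.basicOpen_mul]
    exact Spec.isCompact_basicOpen _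
  toPrespectralSpace :=
    .of_isTopologicalBasis' Spec.isTopologicalBasis_basicOpen Spec.isCompact_basicOpen

end Zariski

/-! ### Orderings and the support map. -/

section Harrison

variable {A : Type u} [CInftyRing A]

/-- A smooth function of one variable that vanishes exactly on `(-∞, 0]`. -/
noncomputable def glue : SmoothFun 1 :=
  ⟨fun t => expNegInvGlue (t 0), expNegInvGlue.contDiff.comp (contDiff_apply ℝ ℝ 0)⟩

/-- The product of the square root with `glue`. -/
noncomputable def sqrtGlue : SmoothFun 1 :=
  ⟨fun t => √(t 0) * expNegInvGlue (t 0),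
    expNegInvGlue.contDiff_sqrt_mul.comp (contDiff_apply ℝ ℝ 0)⟩

theorem glue_eq_zero_iff (t : Fin 1 → ℝ) : glue.1 t = 0 ↔ t 0 ≤ 0 :=
  expNegInvGlue.zero_iff_nonpos

/-- The positive part of an element: it vanishes where the element is nonpositive. -/
noncomputable def posGlue (a : A) : A := op glue fun _ => a

theorem op_glue_comp {n : ℕ} (f : SmoothFun n) (x : Fin n → A) :
    op (glue.comp fun _ => f) x = posGlue (op f x) := op_comp _ _ _

/-- This replaces a square root of a, which need not be smooth at 0: the factor exp(-1/x) repairs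
it. -/
theorem mul_posGlue_sq (a : A) :
    a * (posGlue a * posGlue a) = op sqrtGlue (fun _ => a) * op sqrtGlue fun _ => a := by
  have h : SmoothFun.proj 0 * (glue * glue) = sqrtGlue * sqrtGlue := by
    ext t
    change t 0 * (expNegInvGlue (t 0) * expNegInvGlue (t 0)) =
      √(t 0) * expNegInvGlue (t 0) * (√(t 0) * expNegInvGlue (t 0))
    rcases le_or_gt (t 0) 0 with ht | ht
    · simp [expNegInvGlue.zero_of_nonpos ht]
    · rw [mul_mul_mul_comm, Real.mul_self_sqrt ht.le]
  have h' := congrArg (fun f => op f fun _ => a) h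
  simpa only [op_mul, op_proj, posGlue] using h'

theorem posGlue_mul_posGlue_neg (a : A) : posGlue a * posGlue (-a) = 0 := by
  have h : glue * glue.comp (fun _ => -SmoothFun.proj 0) = 0 := by
    ext t
    change glue.1 t * glue.1 (fun _ => -t 0) = 0
    rcases le_total (t 0) 0 with ht | ht
    · rw [(glue_eq_zero_iff t).2 ht, zero_mul]
    · rw [(glue_eq_zero_iff fun _ => -t 0).2 (neg_nonpos.2 ht), mul_zero]
  have h' := congrArg (fun f => op f fun _ => a) h
  simp only [op_mul, op_glue_comp, op_neg, op_proj, op_zero] at h'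
  exact h'

namespace Spec

variable (p : Spec A)

theorem posGlue_or_neg (a : A) : posGlue a ∈ p.asIdeal ∨ posGlue (-a) ∈ p.asIdeal :=
  p.isPrime.mem_or_mem (by rw [posGlue_mul_posGlue_neg]; exact p.asIdeal.zero_mem)

theorem posGlue_mem {a : A} (ha : a ∈ p.asIdeal) : posGlue a ∈ p.asIdeal := by
  refine p.zeroClosed 1 (SmoothFun.proj 0) glue (fun _ => a) (fun t ht => ?_) ?_
  · exact (glue_eq_zero_iff t).2 (le_of_eq ht)
  · rw [op_proj]
    exact ha

theorem mem_iff_posGlue (a : A) :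
    a ∈ p.asIdeal ↔ posGlue a ∈ p.asIdeal ∧ posGlue (-a) ∈ p.asIdeal := by
  refine ⟨fun ha => ⟨p.posGlue_mem ha, p.posGlue_mem (p.asIdeal.neg_mem ha)⟩, fun h => ?_⟩
  -- This sum of squares vanishes only at 0, the zero of the coordinate.
  have := p.zeroClosed 1 (glue * glue + glue.comp (fun _ => -SmoothFun.proj 0) *
    glue.comp (fun _ => -SmoothFun.proj 0)) (SmoothFun.proj 0) (fun _ => a) (fun t ht => ?_) ?_
  · rwa [op_proj] at this
  · change glue.1 t * glue.1 t + glue.1 (fun _ => -t 0) * glue.1 (fun _ => -t 0) = 0 at ht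
    obtain ⟨h1, h2⟩ := (add_eq_zero_iff_of_nonneg (mul_self_nonneg _) (mul_self_nonneg _)).1 ht
    rw [mul_self_eq_zero, glue_eq_zero_iff] at h1 h2
    exact le_antisymm h1 (neg_nonpos.1 h2)
  · simp only [op_add, op_mul, op_glue_comp, op_neg, op_proj]
    exact p.asIdeal.add_mem (p.asIdeal.mul_mem_left _ h.1) (p.asIdeal.mul_mem_left _ h.2)

/-- Nonnegativity is inherited along smooth functions of two variables that are nonnegative on the
first quadrant. -/
theorem posGlue_neg_op_mem (f : SmoothFun 2) (hf : ∀ t, 0 ≤ t 0 → 0 ≤ t 1 → 0 ≤ f.1 t) {a b : A}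
    (ha : posGlue (-a) ∈ p.asIdeal) (hb : posGlue (-b) ∈ p.asIdeal) :
    posGlue (-op f ![a, b]) ∈ p.asIdeal := by
  let α : SmoothFun 2 := glue.comp fun _ => -SmoothFun.proj 0
  let β : SmoothFun 2 := glue.comp fun _ => -SmoothFun.proj 1
  -- The zero set of α² + β² is the closed first quadrant.
  have := p.zeroClosed 2 (α * α + β * β) (glue.comp fun _ => -f) ![a, b] (fun t ht => ?_) ?_
  · rwa [op_glue_comp, op_neg] at this
  · change glue.1 (fun _ => -t 0) * glue.1 (fun _ => -t 0) +
      glue.1 (fun _ => -t 1) * glue.1 (fun _ => -t 1) = 0 at ht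
    obtain ⟨h1, h2⟩ := (add_eq_zero_iff_of_nonneg (mul_self_nonneg _) (mul_self_nonneg _)).1 ht
    rw [mul_self_eq_zero, glue_eq_zero_iff] at h1 h2
    exact (glue_eq_zero_iff fun _ => -f.1 t).2 (neg_nonpos.2 (hf t (neg_nonpos.1 h1) (neg_nonpos.1 h2)))
  · simp only [α, β, op_add, op_mul, op_glue_comp, op_neg, op_proj]
    exact p.asIdeal.add_mem (p.asIdeal.mul_mem_left _ ha) (p.asIdeal.mul_mem_left _ hb)

/-- The `C^∞`-ordering with a given support. -/
noncomputable def ordering : Sper A where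
  carrier := {a | posGlue (-a) ∈ p.asIdeal}
  add_mem := p.posGlue_neg_op_mem _ fun _ h0 h1 => add_nonneg h0 h1
  mul_mem := p.posGlue_neg_op_mem _ fun _ h0 h1 => mul_nonneg h0 h1
  mem_or_neg_mem a := by
    simp only [Set.mem_ofPred_eq, neg_neg]
    exact (p.posGlue_or_neg a).symm
  exists_support := ⟨p, by
    ext a
    simp only [Set.mem_ofPred_eq, neg_neg, SetLike.mem_coe]
    rw [p.mem_iff_posGlue, and_comm]⟩

theorem supp_ordering : supp p.ordering = p := by
  ext a
  rw [← SetLike.mem_coe, coe_supp, p.mem_iff_posGlue a, and_comm]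
  simp only [ordering, Set.mem_ofPred_eq, neg_neg]

end Spec

namespace Sper

variable (P : Sper A)

theorem mem_supp_iff (a : A) : a ∈ (supp P).asIdeal ↔ a ∈ P.carrier ∧ -a ∈ P.carrier := by
  rw [← SetLike.mem_coe, coe_supp]
  rfl

theorem mul_self_mem (a : A) : a * a ∈ P.carrier := by
  rcases P.mem_or_neg_mem a with h | h
  · exact P.mul_mem h h
  · simpa using P.mul_mem h h

/-- Both a·g(-a)² and its negative lie in P, the latter being a square. So the product is in the
support, which is prime. -/
theorem posGlue_neg_mem {a : A} (ha : a ∈ P.carrier) : posGlue (-a) ∈ (supp P).asIdeal := by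
  have hp := (supp P).isPrime
  have h : a * (posGlue (-a) * posGlue (-a)) ∈ (supp P).asIdeal := by
    refine (P.mem_supp_iff _).2 ⟨P.mul_mem ha (P.mul_self_mem _), ?_⟩
    rw [← neg_mul, mul_posGlue_sq]
    exact P.mul_self_mem _
  rcases hp.mem_or_mem h with h | h
  · exact (supp P).posGlue_mem ((supp P).asIdeal.neg_mem h)
  · exact (hp.mem_or_mem h).elim id id

theorem mem_carrier_iff (a : A) : a ∈ P.carrier ↔ posGlue (-a) ∈ (supp P).asIdeal := by
  refine ⟨P.posGlue_neg_mem, fun h => ?_⟩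
  rcases P.mem_or_neg_mem a with ha | ha
  · exact ha
  · have h' := P.posGlue_neg_mem ha
    rw [neg_neg] at h'
    exact ((P.mem_supp_iff a).1 (((supp P).mem_iff_posGlue a).2 ⟨h', h⟩)).1

theorem harrison_eq (a : A) : harrison a = supp ⁻¹' Spec.basicOpen (posGlue a) := by
  ext P
  change (a ∈ P.carrier ∧ a ∉ (supp P).asIdeal) ↔ posGlue a ∉ (supp P).asIdeal
  rw [mem_carrier_iff, (supp P).mem_iff_posGlue a]
  have := (supp P).posGlue_or_neg a
  tauto

theorem preimage_basicOpen (a : A) : supp ⁻¹' Spec.basicOpen a = harrison (a * a) := by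
  ext P
  have hp := (supp P).isPrime
  change a ∉ (supp P).asIdeal ↔ a * a ∈ P.carrier ∧ a * a ∉ (supp P).asIdeal
  rw [hp.mul_mem_iff_mem_or_mem, or_self, and_iff_right (P.mul_self_mem a)]

end Sper

theorem supp_bijective : Function.Bijective (supp : Sper A → Spec A) := by
  refine ⟨fun P Q h => ?_, fun p => ⟨p.ordering, p.supp_ordering⟩⟩
  ext a
  rw [P.mem_carrier_iff, Q.mem_carrier_iff, h]

/-- Each subbasic open set on one side corresponds to a subbasic open set on the other. -/
theorem supp_isInducing : Topology.IsInducing (supp : Sper A → Spec A) := by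
  refine ⟨le_antisymm (continuous_iff_le_induced.1 (continuous_generateFrom_iff.2 ?_)) ?_⟩
  · rintro _ ⟨a, rfl⟩
    rw [Sper.preimage_basicOpen]
    exact TopologicalSpace.isOpen_generateFrom_of_mem ⟨_, rfl⟩
  · refine le_generateFrom ?_
    rintro _ ⟨a, rfl⟩
    exact ⟨_, Spec.isOpen_basicOpen _, (Sper.harrison_eq a).symm⟩

theorem supp_isHomeomorph : IsHomeomorph (supp : Sper A → Spec A) :=
  isHomeomorph_iff_isEmbedding_surjective.2
    ⟨⟨supp_isInducing, supp_bijective.1⟩, supp_bijective.2⟩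

end Harrison

end CInftyRing

theorem mainTheorem11 (A : Type u) [CInftyRing A] :
    SpectralSpace (CInftyRing.Sper A) ∧ SpectralSpace (CInftyRing.Spec A) ∧
      IsSpectralMap (CInftyRing.supp : CInftyRing.Sper A → CInftyRing.Spec A) ∧
      Function.Bijective (CInftyRing.supp : CInftyRing.Sper A → CInftyRing.Spec A) := by
  have h := CInftyRing.supp_isHomeomorph (A := A)
  have : CompactSpace (CInftyRing.Sper A) := (h.homeomorph _).symm.compactSpace
  exact ⟨h.isOpenEmbedding.spectralSpace, inferInstance,
    (h.homeomorph _).isProperMap.isSpectralMap, h.bijective⟩
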